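/- Let $p\ge 2$ be even and let $(\alpha_n)_{n\ge 0}$ be complex numbers with $|\alpha_n|<1$ and $\alpha_{n+p}=\alpha_n$ for all $n$. Put $\rho_n=(1-|\alpha_n|^2)^{1/2}$. Let $\varphi_n$ be the orthonormal polynomials on the unit circle with Verblunsky coefficients $\alpha_n$: $\varphi_0=1$, $\varphi_{n+1}(z)=\rho_n^{-1}\bigl(z\varphi_n(z)-\bar\alpha_n\varphi_n^*(z)\bigr)$, where $\varphi_n^*(z)=z^n\overline{\varphi_n(1/\bar z)}$. Let $\psi_n$ be the polynomials obtained in the same way from the coefficients $-\alpha_n$. Put $$A_k(z)=\frac1{\rho_k}\begin{pmatrix} z&-\bar\alpha_k\\-z\alpha_k&1\end{pmatrix},\qquad T_p(z)=A_{p-1}(z)\cdots A_0(z),\qquad \Delta(z)=z^{-p/2}\operatorname{Tr}T_p(z),$$ and let the bands be $B=\{z: |z|=1,\ \Delta(z)\in[-2,2]\}$. For $z\in\mathbb C\setminus B$, $z\ne0$, let $\Gamma_+(z),\Gamma_-(z)$ be the eigenvalues of $z^{-p/2}T_p(z)$ with $|\Gamma_+(z)|>|\Gamma_-(z)|$, and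 let $$P_+=\frac{z^{-p/2}T_p-\Gamma_-\mathbf 1}{\Gamma_+-\Gamma_-},\quad a(z)=\tfrac12\Bigl\langle\tbinom11,P_+\tbinom11\Bigr\rangle,\quad b(z)=\tfrac12\Bigl\langle\tbinom1{-1},P_+\tbinom11\Bigr\rangle .$$ At $z=0$ these are read with the eigenvalues $z^{p/2}\Gamma_\pm(z)$ of $T_p(z)$ in place of $\Gamma_\pm(z)$, that is, $z^{p/2}\Gamma_+=\operatorname{Tr}T_p(0)\neq0$, $z^{p/2}\Gamma_-=0$ and $P_+=T_p(0)/\operatorname{Tr}T_p(0)$. For an integer $b\ge0$ (in particular for $0\le b\le p-1$) put $j_b(z)=a(z)\varphi_b(z)+b(z)\psi_b(z)$ on $\mathbb C\setminus B$. Then: 1. For every $z\in\mathbb C\setminus B$, $\displaystyle\lim_{m\to\infty}z^{-mp/2}\,\Gamma_+(z)^{-m}\varphi_{mp+b}(z)=j_b(z)$. 2. $j_b$ is analytic on $\mathbb C\setminus B$, and there is $R$ such that $j_b(z)\neq0$ whenever $|z|>R$. 3. If $z_0\notin B$ and $j_b(z_0)\ne0$, there are $\varepsilon>0$ and $M$ such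 that $\varphi_{mp+b}(z)\neq0$ whenever $|z-z_0|<\varepsilon$ and $m\ge M$. 4. If $z_0\notin B$ and $j_b$ has a zero of order $k$ at $z_0$, there is $\varepsilon_0>0$ such that for every $\varepsilon\in(0,\varepsilon_0]$ and all sufficiently large $m$ (depending on $\varepsilon$) $\varphi_{mp+b}$ has precisely $k$ zeros, counting multiplicity, in $\{z: |z-z_0|<\varepsilon\}$. 5. If the $\alpha_n$ are not all $0$, then there are at most $2p+2b-1$ points $z_0\in\mathbb C\setminus B$ with $j_b(z_0)=0$. -/

import Mathlib

open Filter Topology Polynomial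

noncomputable section

namespace OPUC

/-- `ρ_n = (1 - |α_n|²)^{1/2}`. -/
def rho (α : ℕ → ℂ) (n : ℕ) : ℝ := Real.sqrt (1 - ‖α n‖ ^ 2)

/-- The degree-`n` reversal `f^*(z) = z^n conj (f (1 / conj z))`: the coefficients are conjugated
and the coefficient of `X^i` is exchanged with that of `X^(n-i)`. -/
def star (n : ℕ) (f : ℂ[X]) : ℂ[X] := (f.map (starRingEnd ℂ)).reflect n

/-- The orthonormal polynomials on the unit circle with Verblunsky coefficients `α`, by the Szegő
recursion `φ_0 = 1`, `φ_{n+1} = ρ_n⁻¹ (z φ_n - conj α_n φ_n^*)`. -/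
def phi (α : ℕ → ℂ) : ℕ → ℂ[X]
  | 0 => 1
  | n + 1 => C ((rho α n : ℂ)⁻¹) *
      (X * phi α n - C (starRingEnd ℂ (α n)) * star n (phi α n))

/-- The second kind polynomials: the orthonormal polynomials with Verblunsky coefficients `-α`. -/
def psi (α : ℕ → ℂ) (n : ℕ) : ℂ[X] := phi (fun k => -α k) n

/-- The one-step transfer matrix `A_k(z)`. -/
def stepMatrix (α : ℕ → ℂ) (k : ℕ) (z : ℂ) : Matrix (Fin 2) (Fin 2) ℂ :=
  (rho α k : ℂ)⁻¹ • !![z, -(starRingEnd ℂ (α k)); -(z * α k), 1]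

/-- The transfer matrix `T_n(z) = A_{n-1}(z) ⋯ A_0(z)`. -/
def transfer (α : ℕ → ℂ) : ℕ → ℂ → Matrix (Fin 2) (Fin 2) ℂ
  | 0, _ => 1
  | n + 1, z => stepMatrix α n z * transfer α n z

/-- The discriminant `Δ(z) = z^{-p/2} Tr T_p(z)` (used for even `p` and `z ≠ 0`). -/
def discr (α : ℕ → ℂ) (p : ℕ) (z : ℂ) : ℂ := (z ^ (p / 2))⁻¹ * (transfer α p z).trace

/-- The (union of the) bands: the points of the unit circle at which `Δ(z) ∈ [-2, 2]`. -/
def bands (α : ℕ → ℂ) (p : ℕ) : Set ℂ :=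
  {z | ‖z‖ = 1 ∧ ∃ t : ℝ, t ∈ Set.Icc (-2 : ℝ) 2 ∧ discr α p z = (t : ℂ)}

/-- A square root of a quarter of the discriminant of the characteristic polynomial
`X² - Tr T_p(z) X + z^p` of `T_p(z)`. -/
def charSqrt (α : ℕ → ℂ) (p : ℕ) (z : ℂ) : ℂ :=
  (((transfer α p z).trace / 2) ^ 2 - z ^ p) ^ ((1 : ℂ) / 2)

/-- The eigenvalue of larger modulus of `T_p(z)`. This is `z^{p/2} Γ_+(z)`, and unlike `Γ_+`
it has no pole at `z = 0`. -/
def lamPlus (α : ℕ → ℂ) (p : ℕ) (z : ℂ) : ℂ :=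
  if ‖(transfer α p z).trace / 2 - charSqrt α p z‖ ≤ ‖(transfer α p z).trace / 2 + charSqrt α p z‖
  then (transfer α p z).trace / 2 + charSqrt α p z
  else (transfer α p z).trace / 2 - charSqrt α p z

/-- The other eigenvalue of `T_p(z)`, that is `z^{p/2} Γ_-(z)`. -/
def lamMinus (α : ℕ → ℂ) (p : ℕ) (z : ℂ) : ℂ := (transfer α p z).trace - lamPlus α p z

/-- The eigenvalue `Γ_+(z)` of larger modulus of `z^{-p/2} T_p(z)`, for `z ≠ 0`. -/
def gammaPlus (α : ℕ → ℂ) (p : ℕ) (z : ℂ) : ℂ := (z ^ (p / 2))⁻¹ * lamPlus α p z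

/-- The eigenvalue `Γ_-(z)` of smaller modulus of `z^{-p/2} T_p(z)`, for `z ≠ 0`. -/
def gammaMinus (α : ℕ → ℂ) (p : ℕ) (z : ℂ) : ℂ := (z ^ (p / 2))⁻¹ * lamMinus α p z

/-- The spectral projection `P_+(z)`, written with the eigenvalues of `T_p(z)` so that it also
makes sense at `z = 0`; see `projPlus_eq_gamma` for the form with `Γ_±`. -/
def projPlus (α : ℕ → ℂ) (p : ℕ) (z : ℂ) : Matrix (Fin 2) (Fin 2) ℂ :=
  (lamPlus α p z - lamMinus α p z)⁻¹ •
    (transfer α p z - lamMinus α p z • (1 : Matrix (Fin 2) (Fin 2) ℂ))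

/-- `a(z) = ½ ⟨(1,1), P_+(z) (1,1)⟩`. -/
def coeffA (α : ℕ → ℂ) (p : ℕ) (z : ℂ) : ℂ :=
  (1 / 2) * dotProduct ![1, 1] ((projPlus α p z).mulVec ![1, 1])

/-- `b(z) = ½ ⟨(1,-1), P_+(z) (1,1)⟩`. -/
def coeffB (α : ℕ → ℂ) (p : ℕ) (z : ℂ) : ℂ :=
  (1 / 2) * dotProduct ![1, -1] ((projPlus α p z).mulVec ![1, 1])

/-- `j_b(z) = a(z) φ_b(z) + b(z) ψ_b(z)`. -/
def jost (α : ℕ → ℂ) (p b : ℕ) (z : ℂ) : ℂ :=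
  coeffA α p z * (phi α b).eval z + coeffB α p z * (psi α b).eval z

open Classical in
/-- The number of zeros of the polynomial `f` in the open disk `|z - z₀| < ε`, counted with
multiplicity. -/
def zerosInDisk (f : ℂ[X]) (z₀ : ℂ) (ε : ℝ) : ℕ :=
  f.roots.countP (fun w => ‖w - z₀‖ < ε)

lemma charSqrt_sq (α : ℕ → ℂ) (p : ℕ) (z : ℂ) :
    charSqrt α p z ^ 2 = ((transfer α p z).trace / 2) ^ 2 - z ^ p := by
  have h := Complex.cpow_nat_inv_pow (((transfer α p z).trace / 2) ^ 2 - z ^ p) two_ne_zero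
  rw [charSqrt]
  convert h using 3
  norm_num

/-- `lamPlus` and `lamMinus` are the two roots of `X² - Tr T_p(z) X + z^p`. -/
lemma lamPlus_mul_lamMinus (α : ℕ → ℂ) (p : ℕ) (z : ℂ) :
    lamPlus α p z * lamMinus α p z = z ^ p := by
  have h := charSqrt_sq α p z
  unfold lamMinus lamPlus
  split_ifs <;> linear_combination -h

lemma norm_lamMinus_le (α : ℕ → ℂ) (p : ℕ) (z : ℂ) : ‖lamMinus α p z‖ ≤ ‖lamPlus α p z‖ := by
  have h1 : ∀ t s : ℂ, t - (t / 2 + s) = t / 2 - s := fun t s => by ring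
  have h2 : ∀ t s : ℂ, t - (t / 2 - s) = t / 2 + s := fun t s => by ring
  unfold lamMinus lamPlus
  split_ifs with h
  · rwa [h1]
  · rw [h2]
    exact (not_le.mp h).le

lemma gammaPlus_add_gammaMinus (α : ℕ → ℂ) (p : ℕ) (z : ℂ) :
    gammaPlus α p z + gammaMinus α p z = discr α p z := by
  unfold gammaPlus gammaMinus lamMinus discr; ring

lemma gammaPlus_mul_gammaMinus (α : ℕ → ℂ) {p : ℕ} (hp : Even p) {z : ℂ} (hz : z ≠ 0) :
    gammaPlus α p z * gammaMinus α p z = 1 := by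
  have h := lamPlus_mul_lamMinus α p z
  have h2 : z ^ p = z ^ (p / 2) * z ^ (p / 2) := by
    rw [← pow_add]; congr 1; obtain ⟨q, rfl⟩ := hp; omega
  have h3 : z ^ (p / 2) ≠ 0 := pow_ne_zero _ hz
  unfold gammaPlus gammaMinus
  rw [h2] at h
  field_simp
  linear_combination h

/-- `P_+ = (z^{-p/2} T_p - Γ_-) / (Γ_+ - Γ_-)` for `z ≠ 0`. -/
lemma projPlus_eq_gamma (α : ℕ → ℂ) (p : ℕ) {z : ℂ} (hz : z ≠ 0) :
    projPlus α p z = (gammaPlus α p z - gammaMinus α p z)⁻¹ •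
      ((z ^ (p / 2))⁻¹ • transfer α p z - gammaMinus α p z • (1 : Matrix (Fin 2) (Fin 2) ℂ)) := by
  have h3 : z ^ (p / 2) ≠ 0 := pow_ne_zero _ hz
  unfold gammaPlus gammaMinus projPlus
  rw [← mul_sub, mul_smul ((z ^ (p / 2))⁻¹), ← smul_sub, smul_smul, mul_inv, inv_inv,
    mul_comm (z ^ (p / 2)), mul_assoc, mul_inv_cancel₀ h3, mul_one]

end OPUC

end

/-!
The vector `(φ_n, φ_n^*)` is `T_n (1, 1)`, so by periodicity `φ_{mp+b}` is the first component of
`T_b T_p^m (1, 1)`. Once the two eigenvalues `λ₊, λ₋` of `T_p` differ in modulus,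
`φ_{mp+b} = λ₊^m j_b + λ₋^m (φ_b - j_b)` (`eval_phi_mul_period_add`), and all limit statements follow
from `|λ₋ / λ₊| < 1`. Working with `λ_± = z^{p/2} Γ_±` treats `z = 0` like every other point.

The separation of the eigenvalues off the bands (`norm_lamMinus_lt`) comes from the indefinite form
`|w₁|² - |w₀|²`: one step of the recursion is `diag (z, 1)` followed by an isometry of the form, so
along an eigenvector the form grows faster than `|det T_p| = |z|^p` inside the disk and slower
outside it, which excludes `|λ|² = |z|^p`. On the circle, eigenvalues of equal modulus give
`Γ₋ = conj Γ₊` and `Δ = 2 Re Γ₊ ∈ [-2, 2]`. The same form shows that `j_b` has no zeros outside the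
closed unit disk (`jost_ne_zero_of_one_lt_norm`).

Locally the eigenvalues are `Tr T_p / 2 ± s` with an analytic square root `s`, so `j_b` is analytic and
the convergence is locally uniform (`tendstoLocallyUniformlyOn_phi`). Zeros are then counted by a
version of Hurwitz's theorem (`eventually_zerosInDisk_eq`), proved by integrating logarithmic
derivatives.

At a zero of `j_b` the values `φ_b, φ_{b+p}, φ_{b+2p}` form a geometric progression, so the zeros are
roots of the polynomial `φ_{b+p}² - φ_b φ_{b+2p}`. Its leading coefficient cancels by periodicity, so
its degree is at most `2p + 2b - 1`. It factors as
`(T_p^{(b)})₀₁ z^b (φ_p - φ_p^*)` with the shifted monodromy matrix `T_p^{(b)}`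
(`eval_jostResultant`), which is not identically zero unless all `α_n` vanish.
-/

noncomputable section

namespace OPUC

/-! ### The Szegő recursion and transfer matrices -/

lemma rho_pos {α : ℕ → ℂ} {n : ℕ} (h : ‖α n‖ < 1) : 0 < rho α n := by
  refine Real.sqrt_pos.mpr ?_
  nlinarith [norm_nonneg (α n)]

lemma rho_sq {α : ℕ → ℂ} {n : ℕ} (h : ‖α n‖ < 1) : rho α n ^ 2 = 1 - ‖α n‖ ^ 2 :=
  Real.sq_sqrt (by nlinarith [norm_nonneg (α n)])

lemma rho_ne_zero {α : ℕ → ℂ} {n : ℕ} (h : ‖α n‖ < 1) : (rho α n : ℂ) ≠ 0 :=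
  Complex.ofReal_ne_zero.mpr (rho_pos h).ne'

lemma rho_neg (α : ℕ → ℂ) (n : ℕ) : rho (fun k => -α k) n = rho α n := by
  simp [rho]

lemma natDegree_star_le {n : ℕ} {f : ℂ[X]} (hf : f.natDegree ≤ n) :
    (star n f).natDegree ≤ n := by
  refine (natDegree_reflect_le).trans (max_le le_rfl ?_)
  exact natDegree_map_le.trans hf

lemma star_C_mul (n : ℕ) (c : ℂ) (f : ℂ[X]) :
    star n (C c * f) = C (starRingEnd ℂ c) * star n f := by
  simp [star, reflect_C_mul]

lemma star_sub (n : ℕ) (f g : ℂ[X]) : star n (f - g) = star n f - star n g := by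
  simp [star, reflect_sub]

lemma star_star (n : ℕ) (f : ℂ[X]) : star n (star n f) = f := by
  ext i
  simp [star, coeff_reflect, coeff_map]

lemma star_succ_X_mul {n : ℕ} {f : ℂ[X]} (hf : f.natDegree ≤ n) :
    star (n + 1) (X * f) = star n f := by
  have h := reflect_mul (X : ℂ[X]) (f.map (starRingEnd ℂ)) (F := 1) (G := n) natDegree_X_le
    (natDegree_map_le.trans hf)
  have h1 : reflect 1 (X : ℂ[X]) = 1 := by
    simp
  rw [star, Polynomial.map_mul, map_X, add_comm n 1, h, h1, one_mul, star]

lemma star_succ {n : ℕ} {f : ℂ[X]} (hf : f.natDegree ≤ n) :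
    star (n + 1) f = X * star n f := by
  have h := star_succ_X_mul (natDegree_star_le hf)
  rw [star_star] at h
  rw [← star_star (n + 1) (X * star n f), h]

lemma natDegree_phi_le (α : ℕ → ℂ) (n : ℕ) : (phi α n).natDegree ≤ n := by
  induction n with
  | zero => simp [phi]
  | succ n ih =>
    rw [phi]
    refine (natDegree_C_mul_le _ _).trans ((natDegree_sub_le _ _).trans (max_le ?_ ?_))
    · exact natDegree_mul_le.trans (by rw [natDegree_X]; lia)
    · exact (natDegree_C_mul_le _ _).trans ((natDegree_star_le ih).trans n.le_succ)

/-- The recursion for the reversed polynomials `φ_n^*`. -/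
lemma star_phi_succ (α : ℕ → ℂ) (n : ℕ) :
    star (n + 1) (phi α (n + 1)) =
      C ((rho α n : ℂ)⁻¹) * (star n (phi α n) - C (α n) * (X * phi α n)) := by
  have h := natDegree_phi_le α n
  rw [phi, star_C_mul, star_sub, star_succ_X_mul h, star_C_mul, star_succ (natDegree_star_le h),
    star_star]
  simp

/-- The leading coefficient `κ_n = ∏ ρ_k⁻¹` of `φ_n`. -/
lemma coeff_phi_self (α : ℕ → ℂ) (n : ℕ) :
    (phi α n).coeff n = ∏ k ∈ Finset.range n, (rho α k : ℂ)⁻¹ := by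
  induction n with
  | zero => simp [phi]
  | succ n ih =>
    have h : (star n (phi α n)).coeff (n + 1) = 0 :=
      coeff_eq_zero_of_natDegree_lt
        (Nat.lt_succ_of_le (natDegree_star_le (natDegree_phi_le α n)))
    rw [phi, coeff_C_mul, coeff_sub, coeff_X_mul, coeff_C_mul, h, ih, Finset.prod_range_succ]
    ring

/-- Transfer matrices carry `(1, 1)` to `(φ_n, φ_n^*)`. -/
lemma transfer_mulVec_one_one (α : ℕ → ℂ) (n : ℕ) (z : ℂ) :
    (transfer α n z).mulVec ![1, 1] = ![(phi α n).eval z, (star n (phi α n)).eval z] := by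
  induction n with
  | zero => simp [transfer, phi, star]
  | succ n ih =>
    rw [transfer, ← Matrix.mulVec_mulVec, ih, star_phi_succ, phi, stepMatrix]
    ext i
    fin_cases i <;> simp [Matrix.mulVec, dotProduct, Fin.sum_univ_two] <;> ring

/-- Transfer matrices carry `(1, -1)` to `(ψ_n, -ψ_n^*)`. -/
lemma transfer_mulVec_one_neg_one (α : ℕ → ℂ) (n : ℕ) (z : ℂ) :
    (transfer α n z).mulVec ![1, -1] = ![(psi α n).eval z, -(star n (psi α n)).eval z] := by
  unfold psi
  induction n with
  | zero => simp [transfer, phi, star]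
  | succ n ih =>
    rw [transfer, ← Matrix.mulVec_mulVec, ih, star_phi_succ, phi, stepMatrix, rho_neg]
    ext i
    fin_cases i <;> simp [Matrix.mulVec, dotProduct, Fin.sum_univ_two] <;> ring

lemma eval_phi (α : ℕ → ℂ) (n : ℕ) (z : ℂ) :
    (phi α n).eval z = (transfer α n z).mulVec ![1, 1] 0 := by
  rw [transfer_mulVec_one_one]; rfl

lemma eval_psi (α : ℕ → ℂ) (n : ℕ) (z : ℂ) :
    (psi α n).eval z = (transfer α n z).mulVec ![1, -1] 0 := by
  rw [transfer_mulVec_one_neg_one]; rfl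

lemma transfer_add (α : ℕ → ℂ) (m n : ℕ) (z : ℂ) :
    transfer α (m + n) z = transfer (fun k => α (m + k)) n z * transfer α m z := by
  induction n with
  | zero => simp [transfer]
  | succ n ih =>
    rw [← add_assoc, transfer, ih, transfer, Matrix.mul_assoc]
    rfl

lemma transfer_period_add {α : ℕ → ℂ} {p : ℕ} (hper : ∀ n, α (n + p) = α n) (n : ℕ) (z : ℂ) :
    transfer α (n + p) z = transfer α n z * transfer α p z := by
  rw [add_comm, transfer_add]
  congr 2
  ext k
  rw [add_comm, hper]

lemma det_stepMatrix {α : ℕ → ℂ} {k : ℕ} (h : ‖α k‖ < 1) (z : ℂ) :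
    (stepMatrix α k z).det = z := by
  have h1 := rho_sq h
  have h2 : (rho α k : ℂ) ^ 2 = 1 - α k * starRingEnd ℂ (α k) := by
    rw [Complex.mul_conj, Complex.normSq_eq_norm_sq]
    exact_mod_cast h1
  have h3 := rho_ne_zero h
  rw [stepMatrix, Matrix.det_smul, Matrix.det_fin_two_of]
  simp only [Fintype.card_fin]
  field_simp
  rw [h2]
  ring

lemma det_transfer {α : ℕ → ℂ} (h : ∀ n, ‖α n‖ < 1) (n : ℕ) (z : ℂ) :
    (transfer α n z).det = z ^ n := by
  induction n with
  | zero => simp [transfer]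
  | succ n ih => rw [transfer, Matrix.det_mul, det_stepMatrix (h n), ih, pow_succ']

lemma transfer_mulVec_ne_zero {α : ℕ → ℂ} (h : ∀ n, ‖α n‖ < 1) (n : ℕ) {z : ℂ} (hz : z ≠ 0)
    {w : Fin 2 → ℂ} (hw : w ≠ 0) : (transfer α n z).mulVec w ≠ 0 := by
  intro h0
  have := Matrix.exists_mulVec_eq_zero_iff.mp ⟨w, hw, h0⟩
  rw [det_transfer h] at this
  exact pow_ne_zero n hz this

lemma differentiable_transfer (α : ℕ → ℂ) (n : ℕ) (i j : Fin 2) :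
    Differentiable ℂ fun z => transfer α n z i j := by
  induction n generalizing i j with
  | zero => simp [transfer]
  | succ n ih =>
    have h1 : ∀ k, Differentiable ℂ fun z => stepMatrix α n z i k := by
      intro k
      fin_cases i <;> fin_cases k <;> (simp [stepMatrix]; try fun_prop)
    simp only [transfer, Matrix.mul_apply, Fin.sum_univ_two]
    exact ((h1 0).mul (ih 0 j)).add ((h1 1).mul (ih 1 j))

lemma differentiable_trace_transfer (α : ℕ → ℂ) (n : ℕ) :
    Differentiable ℂ fun z => (transfer α n z).trace := by
  simp only [Matrix.trace_fin_two]
  exact (differentiable_transfer α n 0 0).add (differentiable_transfer α n 1 1)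

/-! ### The indefinite form `|w₁|² - |w₀|²` along the recursion -/

/-- The indefinite Hermitian form `|w₁|² - |w₀|²` on `ℂ²`. -/
def sig (w : Fin 2 → ℂ) : ℝ := ‖w 1‖ ^ 2 - ‖w 0‖ ^ 2

lemma sig_smul (c : ℂ) (w : Fin 2 → ℂ) : sig (c • w) = ‖c‖ ^ 2 * sig w := by
  simp [sig]; ring

/-- The step matrix is `diag (z, 1)` followed by an isometry of the form. -/
lemma sig_stepMatrix {α : ℕ → ℂ} {k : ℕ} (h : ‖α k‖ < 1) (z : ℂ) (w : Fin 2 → ℂ) :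
    sig ((stepMatrix α k z).mulVec w) = ‖w 1‖ ^ 2 - ‖z‖ ^ 2 * ‖w 0‖ ^ 2 := by
  have h1 := rho_sq h
  have h2 := (rho_pos h).ne'
  have e : (stepMatrix α k z).mulVec w = (rho α k : ℂ)⁻¹ •
      ![z * w 0 - starRingEnd ℂ (α k) * w 1, w 1 - α k * (z * w 0)] := by
    rw [stepMatrix, Matrix.smul_mulVec]
    congr 1
    ext i
    fin_cases i <;> simp [Matrix.mulVec, dotProduct, Fin.sum_univ_two] <;> ring
  rw [e, sig_smul, norm_inv, Complex.norm_real, Real.norm_eq_abs, inv_pow, sq_abs,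
    ← mul_pow, ← norm_mul, inv_mul_eq_iff_eq_mul₀ (pow_ne_zero 2 h2), h1]
  generalize z * w 0 = a
  simp only [sig, Matrix.cons_val_zero, Matrix.cons_val_one, Complex.sq_norm, Complex.normSq_apply,
    Complex.sub_re, Complex.sub_im, Complex.mul_re, Complex.mul_im, Complex.conj_re,
    Complex.conj_im]
  ring

lemma norm_sq_add_pos {w : Fin 2 → ℂ} (hw : w ≠ 0) : 0 < ‖w 0‖ ^ 2 + ‖w 1‖ ^ 2 := by
  by_contra h
  refine hw ?_
  have h0 : ‖w 0‖ = 0 := by nlinarith [sq_nonneg ‖w 0‖, sq_nonneg ‖w 1‖]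
  have h1 : ‖w 1‖ = 0 := by nlinarith [sq_nonneg ‖w 0‖, sq_nonneg ‖w 1‖]
  ext i
  fin_cases i
  · simpa using h0
  · simpa using h1

lemma sig_le_sig_transfer {α : ℕ → ℂ} (h : ∀ n, ‖α n‖ < 1) {z : ℂ} (hz : ‖z‖ ≤ 1) (n : ℕ)
    (w : Fin 2 → ℂ) : sig w ≤ sig ((transfer α n z).mulVec w) := by
  induction n with
  | zero => simp [transfer]
  | succ n ih =>
    rw [transfer, ← Matrix.mulVec_mulVec, sig_stepMatrix (h n)]
    refine ih.trans ?_
    have : ‖z‖ ^ 2 ≤ 1 := pow_le_one₀ (norm_nonneg z) hz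
    rw [sig]
    nlinarith [sq_nonneg ‖(transfer α n z).mulVec w 0‖]

lemma sig_transfer_le_sig {α : ℕ → ℂ} (h : ∀ n, ‖α n‖ < 1) {z : ℂ} (hz : 1 ≤ ‖z‖) (n : ℕ)
    (w : Fin 2 → ℂ) : sig ((transfer α n z).mulVec w) ≤ sig w := by
  induction n with
  | zero => simp [transfer]
  | succ n ih =>
    rw [transfer, ← Matrix.mulVec_mulVec, sig_stepMatrix (h n)]
    refine le_trans ?_ ih
    have : 1 ≤ ‖z‖ ^ 2 := one_le_pow₀ hz
    rw [sig]
    nlinarith [sq_nonneg ‖(transfer α n z).mulVec w 0‖]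

/-- Inside the disk the form grows strictly faster than `|det T_n|`, so that no eigenvalue of `T_n`
can have modulus `|det T_n|^{1/2}`. -/
lemma pow_mul_sig_lt_sig_transfer {α : ℕ → ℂ} (h : ∀ n, ‖α n‖ < 1) {z : ℂ} (hz0 : z ≠ 0)
    (hz : ‖z‖ < 1) {n : ℕ} (hn : 0 < n) {w : Fin 2 → ℂ} (hw : w ≠ 0) :
    ‖z‖ ^ n * sig w < sig ((transfer α n z).mulVec w) := by
  have hp := norm_pos_iff.mpr hz0
  have step : ∀ m, ‖z‖ * sig ((transfer α m z).mulVec w) <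
      sig ((transfer α (m + 1) z).mulVec w) := by
    intro m
    rw [transfer, ← Matrix.mulVec_mulVec, sig_stepMatrix (h m), sig]
    have h1 := norm_sq_add_pos (transfer_mulVec_ne_zero h m hz0 hw)
    set x := (transfer α m z).mulVec w
    nlinarith [mul_nonneg (mul_nonneg hp.le (sub_nonneg.mpr hz.le)) (sq_nonneg ‖x 0‖),
      mul_nonneg (sub_nonneg.mpr hz.le) (sq_nonneg ‖x 1‖),
      mul_pos (mul_pos hp (sub_pos.mpr hz)) h1,
      mul_nonneg (mul_nonneg (sub_nonneg.mpr hz.le) (sub_nonneg.mpr hz.le)) (sq_nonneg ‖x 1‖)]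
  induction n, hn using Nat.le_induction with
  | base => simpa [transfer] using step 0
  | succ m hm ih =>
    refine lt_trans ?_ (step m)
    rw [pow_succ', mul_assoc]
    exact mul_lt_mul_of_pos_left ih hp

/-- Outside the disk the form grows strictly slower than `|det T_n|`. -/
lemma sig_transfer_lt_pow_mul_sig {α : ℕ → ℂ} (h : ∀ n, ‖α n‖ < 1) {z : ℂ}
    (hz : 1 < ‖z‖) {n : ℕ} (hn : 0 < n) {w : Fin 2 → ℂ} (hw : w ≠ 0) :
    sig ((transfer α n z).mulVec w) < ‖z‖ ^ n * sig w := by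
  have hp : 0 < ‖z‖ := zero_lt_one.trans hz
  have hz0 := norm_pos_iff.mp hp
  have step : ∀ m, sig ((transfer α (m + 1) z).mulVec w) <
      ‖z‖ * sig ((transfer α m z).mulVec w) := by
    intro m
    rw [transfer, ← Matrix.mulVec_mulVec, sig_stepMatrix (h m), sig]
    have h1 := norm_sq_add_pos (transfer_mulVec_ne_zero h m hz0 hw)
    set x := (transfer α m z).mulVec w
    nlinarith [mul_pos (sub_pos.mpr hz) h1,
      mul_nonneg (mul_nonneg (sub_nonneg.mpr hz.le) (sub_nonneg.mpr hz.le)) (sq_nonneg ‖x 0‖)]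
  induction n, hn using Nat.le_induction with
  | base => simpa [transfer] using step 0
  | succ m hm ih =>
    refine (step m).trans ?_
    rw [pow_succ', mul_assoc]
    exact mul_lt_mul_of_pos_left ih hp

/-! ### Separation of the eigenvalues off the bands -/

/-- The Cayley–Hamilton theorem for `2 × 2` matrices, applied to a vector. -/
lemma mulVec_mulVec_fin_two (M : Matrix (Fin 2) (Fin 2) ℂ) (w : Fin 2 → ℂ) :
    M.mulVec (M.mulVec w) = M.trace • M.mulVec w - M.det • w := by
  ext i
  fin_cases i <;>
    simp [Matrix.mulVec, dotProduct, Fin.sum_univ_two, Matrix.trace_fin_two,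
      Matrix.det_fin_two] <;> ring

lemma lamPlus_add_lamMinus (α : ℕ → ℂ) (p : ℕ) (z : ℂ) :
    lamPlus α p z + lamMinus α p z = (transfer α p z).trace := by
  rw [lamMinus]; ring

lemma exists_eigenvector_lamPlus {α : ℕ → ℂ} (h : ∀ n, ‖α n‖ < 1) (p : ℕ) (z : ℂ) :
    ∃ w : Fin 2 → ℂ, w ≠ 0 ∧ (transfer α p z).mulVec w = lamPlus α p z • w := by
  have hd : (transfer α p z - lamPlus α p z • (1 : Matrix (Fin 2) (Fin 2) ℂ)).det = 0 := by
    have h1 := lamPlus_mul_lamMinus α p z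
    have h2 := lamPlus_add_lamMinus α p z
    rw [← det_transfer h p z, Matrix.det_fin_two] at h1
    rw [Matrix.trace_fin_two] at h2
    rw [Matrix.det_fin_two]
    simp
    linear_combination lamPlus α p z * h2 - h1
  obtain ⟨w, hw, h0⟩ := Matrix.exists_mulVec_eq_zero_iff.mpr hd
  refine ⟨w, hw, ?_⟩
  rwa [Matrix.sub_mulVec, Matrix.smul_mulVec, Matrix.one_mulVec, sub_eq_zero] at h0

lemma norm_lamMinus_lt {α : ℕ → ℂ} {p : ℕ} (hp : 0 < p) (hpe : Even p) (h : ∀ n, ‖α n‖ < 1)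
    {z : ℂ} (hz : z ∉ bands α p) : ‖lamMinus α p z‖ < ‖lamPlus α p z‖ := by
  by_contra hlt
  have heq : ‖lamMinus α p z‖ = ‖lamPlus α p z‖ :=
    le_antisymm (norm_lamMinus_le α p z) (not_lt.mp hlt)
  have hmul := lamPlus_mul_lamMinus α p z
  have hnorm : ‖lamPlus α p z‖ ^ 2 = ‖z‖ ^ p := by
    rw [← norm_pow z, ← hmul, norm_mul, heq, sq]
  obtain ⟨w, hw, hTw⟩ := exists_eigenvector_lamPlus h p z
  have hsig : sig ((transfer α p z).mulVec w) = ‖z‖ ^ p * sig w := by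
    rw [hTw, sig_smul, hnorm]
  rcases lt_trichotomy ‖z‖ 1 with h1 | h1 | h1
  · rcases eq_or_ne z 0 with rfl | h0
    · -- a nilpotent `T_p(0)` would contradict the growth of the form along `(0, 1)`
      rw [norm_zero, zero_pow hp.ne', sq_eq_zero_iff, norm_eq_zero] at hnorm
      have h2 : lamMinus α p 0 = 0 := by rw [← norm_eq_zero, heq, hnorm, norm_zero]
      have htr := lamPlus_add_lamMinus α p 0
      rw [hnorm, h2, add_zero] at htr
      have hCH := mulVec_mulVec_fin_two (transfer α p 0) ![0, 1]
      rw [← htr, det_transfer h, zero_pow hp.ne', zero_smul, zero_smul, sub_zero] at hCH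
      have h3 := sig_le_sig_transfer h h1.le p ((transfer α p 0).mulVec ![0, 1])
      have h4 := sig_le_sig_transfer h h1.le p ![0, 1]
      rw [hCH] at h3
      simp [sig] at h3 h4
      linarith
    · exact (pow_mul_sig_lt_sig_transfer h h0 h1 hp hw).ne' hsig
  · have h0 : z ≠ 0 := by rintro rfl; simp at h1
    refine hz ⟨h1, 2 * (gammaPlus α p z).re, ?_, ?_⟩
    all_goals
      have hg : ‖gammaPlus α p z‖ = 1 := by
        rw [h1, one_pow, pow_eq_one_iff_of_nonneg (norm_nonneg _) two_ne_zero] at hnorm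
        simp [gammaPlus, h1, hnorm]
    · have := abs_le.mp ((Complex.abs_re_le_norm _).trans hg.le)
      constructor <;> linarith
    · -- `Γ₋` is the inverse of the unimodular number `Γ₊`
      have h2 : gammaMinus α p z = starRingEnd ℂ (gammaPlus α p z) := by
        rw [← Complex.inv_eq_conj hg]
        exact eq_inv_of_mul_eq_one_right (gammaPlus_mul_gammaMinus α hpe h0)
      rw [← gammaPlus_add_gammaMinus, h2, Complex.add_conj]
  · exact (sig_transfer_lt_pow_mul_sig h h1 hp hw).ne hsig

/-! ### The Jost function and the polynomials along a residue class -/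

lemma lamPlus_sub_lamMinus_ne_zero {α : ℕ → ℂ} {p : ℕ} {z : ℂ}
    (hz : ‖lamMinus α p z‖ < ‖lamPlus α p z‖) : lamPlus α p z - lamMinus α p z ≠ 0 := by
  intro h0
  rw [sub_eq_zero.mp h0] at hz
  exact lt_irrefl _ hz

/-- `j_b` is the first component of `T_b P₊ (1, 1)`. -/
lemma jost_eq_mulVec (α : ℕ → ℂ) (p b : ℕ) (z : ℂ) :
    jost α p b z =
      (transfer α b z).mulVec ((projPlus α p z).mulVec ![1, 1]) 0 := by
  have h : (projPlus α p z).mulVec ![1, 1] =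
      coeffA α p z • ![1, 1] + coeffB α p z • ![1, -1] := by
    ext i
    fin_cases i <;> simp [coeffA, coeffB, dotProduct, Fin.sum_univ_two] <;> ring
  rw [jost, eval_phi, eval_psi, h, Matrix.mulVec_add, Matrix.mulVec_smul, Matrix.mulVec_smul]
  simp

lemma sub_mul_jost_eq_mulVec {α : ℕ → ℂ} {p : ℕ} (b : ℕ) {z : ℂ}
    (hz : ‖lamMinus α p z‖ < ‖lamPlus α p z‖) :
    (lamPlus α p z - lamMinus α p z) * jost α p b z = (transfer α b z).mulVec
      ((transfer α p z).mulVec ![1, 1] - lamMinus α p z • ![1, 1]) 0 := by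
  rw [jost_eq_mulVec, projPlus, Matrix.smul_mulVec, Matrix.mulVec_smul, Matrix.sub_mulVec,
    Matrix.smul_mulVec, Matrix.one_mulVec, Pi.smul_apply, smul_eq_mul,
    mul_inv_cancel_left₀ (lamPlus_sub_lamMinus_ne_zero hz)]

lemma sub_mul_jost {α : ℕ → ℂ} {p : ℕ} (hper : ∀ n, α (n + p) = α n) (b : ℕ) {z : ℂ}
    (hz : ‖lamMinus α p z‖ < ‖lamPlus α p z‖) :
    (lamPlus α p z - lamMinus α p z) * jost α p b z =
      (phi α (b + p)).eval z - lamMinus α p z * (phi α b).eval z := by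
  rw [sub_mul_jost_eq_mulVec b hz, Matrix.mulVec_sub, Matrix.mulVec_smul, Matrix.mulVec_mulVec,
    ← transfer_period_add hper, eval_phi, eval_phi]
  simp

/-- Three-term recursion along a residue class, by Cayley–Hamilton for `T_p`. -/
lemma eval_phi_add_two_period {α : ℕ → ℂ} {p : ℕ} (h : ∀ n, ‖α n‖ < 1)
    (hper : ∀ n, α (n + p) = α n) (n : ℕ) (z : ℂ) :
    (phi α (n + p + p)).eval z =
      (transfer α p z).trace * (phi α (n + p)).eval z - z ^ p * (phi α n).eval z := by
  simp only [eval_phi, transfer_period_add hper, ← Matrix.mulVec_mulVec]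
  rw [mulVec_mulVec_fin_two, det_transfer h, Matrix.mulVec_sub, Matrix.mulVec_smul,
    Matrix.mulVec_smul]
  simp

lemma eval_phi_mul_period_add {α : ℕ → ℂ} {p : ℕ} (h : ∀ n, ‖α n‖ < 1)
    (hper : ∀ n, α (n + p) = α n) (b : ℕ) {z : ℂ} (hz : ‖lamMinus α p z‖ < ‖lamPlus α p z‖)
    (m : ℕ) :
    (phi α (m * p + b)).eval z = lamPlus α p z ^ m * jost α p b z +
      lamMinus α p z ^ m * ((phi α b).eval z - jost α p b z) := by
  have hs := lamPlus_add_lamMinus α p z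
  have hmul := lamPlus_mul_lamMinus α p z
  have hj := sub_mul_jost hper b hz
  induction m using Nat.twoStepInduction with
  | zero => simp
  | one =>
    rw [one_mul, add_comm p b]
    linear_combination -hj
  | more m h0 h1 =>
    have e1 : (m + 1) * p + b = m * p + b + p := by ring
    have e2 : (m + 2) * p + b = m * p + b + p + p := by ring
    rw [e2, eval_phi_add_two_period h hper, ← e1, h1, h0, ← hs, ← hmul]
    ring

/-- Outside the closed unit disk the form is negative on `P₊ (1, 1)` and hence on
`T_b P₊ (1, 1)`, whose first component is `j_b`. -/
lemma jost_ne_zero_of_one_lt_norm {α : ℕ → ℂ} {p : ℕ} (hp : 0 < p) (hpe : Even p)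
    (h : ∀ n, ‖α n‖ < 1) (b : ℕ) {z : ℂ} (hz1 : 1 < ‖z‖) : jost α p b z ≠ 0 := by
  have hz : ‖lamMinus α p z‖ < ‖lamPlus α p z‖ :=
    norm_lamMinus_lt hp hpe h fun hb => hz1.ne' hb.1
  set v := (transfer α p z).mulVec ![1, 1] - lamMinus α p z • ![1, 1] with hv
  have hs := lamPlus_add_lamMinus α p z
  have hmul := lamPlus_mul_lamMinus α p z
  have he : sig ![1, 1] = 0 := by simp [sig]
  have he0 : (![1, 1] : Fin 2 → ℂ) ≠ 0 := fun h0 => by simpa using congrFun h0 0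
  have hv0 : v ≠ 0 := by
    intro h0
    have h1 := sig_transfer_lt_pow_mul_sig h hz1 hp he0
    rw [sub_eq_zero.mp h0, sig_smul, he] at h1
    simp at h1
  have hTv : (transfer α p z).mulVec v = lamPlus α p z • v := by
    rw [hv, Matrix.mulVec_sub, mulVec_mulVec_fin_two, Matrix.mulVec_smul, ← hs,
      det_transfer h, ← hmul]
    module
  have hlt := sig_transfer_lt_pow_mul_sig h hz1 hp hv0
  rw [hTv, sig_smul, ← norm_pow z, ← hmul, norm_mul] at hlt
  have hneg : sig v < 0 := by
    have h1 : 0 < ‖lamPlus α p z‖ * (‖lamPlus α p z‖ - ‖lamMinus α p z‖) :=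
      mul_pos ((norm_nonneg _).trans_lt hz) (sub_pos.mpr hz)
    by_contra h2
    nlinarith [mul_nonneg h1.le (not_lt.mp h2)]
  intro hj
  have h1 := (sig_transfer_le_sig h hz1.le b v).trans_lt hneg
  rw [sig, ← sub_mul_jost_eq_mulVec b hz, hj, mul_zero, norm_zero] at h1
  nlinarith [sq_nonneg ‖(transfer α b z).mulVec v 1‖]

/-! ### Hurwitz's theorem for polynomials with non-vanishing weights -/

open Classical in
/-- The circle integral of `∑ 1 / (z - w)` counts the points `w` inside the circle. -/
lemma circleIntegral_sum_one_div_sub (s : Multiset ℂ) {c : ℂ} {R : ℝ} (hR : 0 < R)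
    (hs : ∀ w ∈ s, ‖w - c‖ ≠ R) :
    CircleIntegrable (fun z => (s.map fun w => 1 / (z - w)).sum) c R ∧
    (∮ z in C(c, R), (s.map fun w => 1 / (z - w)).sum) =
      2 * Real.pi * Complex.I * (s.countP fun w => ‖w - c‖ < R : ℕ) := by
  induction s using Multiset.induction_on with
  | empty => simp [circleIntegral]
  | cons a s ih =>
    obtain ⟨h1, h2⟩ := ih fun w hw => hs w (Multiset.mem_cons_of_mem hw)
    have ha := hs a (Multiset.mem_cons_self a s)
    have hai : CircleIntegrable (fun z => 1 / (z - a)) c R := by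
      simp only [one_div]
      refine circleIntegrable_sub_inv_iff.mpr (Or.inr ?_)
      rwa [mem_sphere_iff_norm, abs_of_pos hR]
    simp only [Multiset.map_cons, Multiset.sum_cons]
    refine ⟨hai.add h1, ?_⟩
    rw [circleIntegral.integral_add hai h1, h2]
    rcases lt_or_gt_of_ne ha with hlt | hgt
    · rw [Multiset.countP_cons_of_pos (p := fun w => ‖w - c‖ < R) _ hlt]
      simp only [one_div]
      rw [circleIntegral.integral_sub_inv_of_mem_ball (mem_ball_iff_norm.mpr hlt)]
      push_cast
      ring
    · rw [Multiset.countP_cons_of_neg (p := fun w => ‖w - c‖ < R) _ hgt.not_gt]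
      have hd : DifferentiableOn ℂ (fun z => 1 / (z - a)) (Metric.closedBall c R) := by
        intro z hz
        have hza : z - a ≠ 0 := by
          intro h0
          rw [sub_eq_zero.mp h0, mem_closedBall_iff_norm] at hz
          exact absurd hgt hz.not_gt
        have : DifferentiableAt ℂ (fun z => 1 / (z - a)) z := by fun_prop (disch := exact hza)
        exact this.differentiableWithinAt
      rw [(hd.diffContOnCl_ball subset_rfl).circleIntegral_eq_zero hR.le, zero_add]

/-- The argument principle for polynomials on a circle. -/
lemma circleIntegral_logDeriv_eval (P : ℂ[X]) {c : ℂ} {R : ℝ} (hR : 0 < R)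
    (hP : ∀ z ∈ Metric.sphere c R, P.eval z ≠ 0) :
    (∮ z in C(c, R), logDeriv (fun z => P.eval z) z) =
      2 * Real.pi * Complex.I * (zerosInDisk P c R : ℕ) := by
  have hs : ∀ w ∈ P.roots, ‖w - c‖ ≠ R := fun w hw h =>
    hP w (mem_sphere_iff_norm.mpr h) (isRoot_of_mem_roots hw)
  rw [zerosInDisk, ← (circleIntegral_sum_one_div_sub P.roots hR hs).2]
  refine circleIntegral.integral_congr hR.le fun z hz => ?_
  rw [logDeriv_apply, Polynomial.deriv,
    (IsAlgClosed.splits P).eval_derivative_div_eval_of_ne_zero (hP z hz)]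

lemma circleIntegral_logDeriv_eq_zero {U : Set ℂ} (hU : IsOpen U) {c : ℂ} {R : ℝ} (hR : 0 < R)
    (hUR : Metric.closedBall c R ⊆ U) {h : ℂ → ℂ} (hh : DifferentiableOn ℂ h U)
    (h0 : ∀ z ∈ U, h z ≠ 0) : (∮ z in C(c, R), logDeriv h z) = 0 := by
  have : DifferentiableOn ℂ (logDeriv h) U := (hh.deriv hU).div hh h0
  exact (this.diffContOnCl_ball hUR).circleIntegral_eq_zero hR.le

lemma continuousOn_logDeriv {U : Set ℂ} (hU : IsOpen U) {h : ℂ → ℂ} (hh : DifferentiableOn ℂ h U)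
    {S : Set ℂ} (hS : S ⊆ U) (h0 : ∀ z ∈ S, h z ≠ 0) : ContinuousOn (logDeriv h) S :=
  ((hh.deriv hU).continuousOn.mono hS).div (hh.continuousOn.mono hS) h0

/-- The argument principle for a polynomial times a function without zeros. -/
lemma circleIntegral_logDeriv_mul_eval {U : Set ℂ} (hU : IsOpen U) {c : ℂ} {R : ℝ} (hR : 0 < R)
    (hUR : Metric.closedBall c R ⊆ U) {h : ℂ → ℂ} (hh : DifferentiableOn ℂ h U)
    (h0 : ∀ z ∈ U, h z ≠ 0) (P : ℂ[X]) (hP : ∀ z ∈ Metric.sphere c R, P.eval z ≠ 0) :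
    (∮ z in C(c, R), logDeriv (fun z => h z * P.eval z) z) =
      2 * Real.pi * Complex.I * (zerosInDisk P c R : ℕ) := by
  have hS : Metric.sphere c R ⊆ U := Metric.sphere_subset_closedBall.trans hUR
  have e : Set.EqOn (logDeriv fun z => h z * P.eval z)
      (fun z => logDeriv h z + logDeriv (fun z => P.eval z) z) (Metric.sphere c R) := fun z hz =>
    logDeriv_mul z (h0 z (hS hz)) (hP z hz) (hh.differentiableAt (hU.mem_nhds (hS hz)))
      P.differentiable.differentiableAt
  rw [circleIntegral.integral_congr hR.le e, circleIntegral.integral_add,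
    circleIntegral_logDeriv_eq_zero hU hR hUR hh h0, circleIntegral_logDeriv_eval P hR hP, zero_add]
  · exact (continuousOn_logDeriv hU hh hS fun z hz => h0 z (hS hz)).circleIntegrable hR.le
  · exact (continuousOn_logDeriv isOpen_univ P.differentiable.differentiableOn
      (Set.subset_univ _) hP).circleIntegrable hR.le

/-- **Hurwitz's theorem**: if `h_m P_m → (z - c)^k g` locally uniformly, where the `h_m` and `g`
have no zeros, then eventually `P_m` has exactly `k` zeros in the disk of radius `R` about `c`. -/
theorem eventually_zerosInDisk_eq {U : Set ℂ} (hU : IsOpen U) {c : ℂ} {R : ℝ} (hR : 0 < R)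
    (hUR : Metric.closedBall c R ⊆ U) {g : ℂ → ℂ} (hg : DifferentiableOn ℂ g U)
    (hg0 : ∀ z ∈ U, g z ≠ 0) {k : ℕ} {h : ℕ → ℂ → ℂ} (hh : ∀ m, DifferentiableOn ℂ (h m) U)
    (h0 : ∀ m, ∀ z ∈ U, h m z ≠ 0) {P : ℕ → ℂ[X]}
    (hlim : TendstoLocallyUniformlyOn (fun m z => h m z * (P m).eval z)
      (fun z => (z - c) ^ k * g z) atTop U) :
    ∀ᶠ m in atTop, zerosInDisk (P m) c R = k := by
  have hS : Metric.sphere c R ⊆ U := Metric.sphere_subset_closedBall.trans hUR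
  have hd : ∀ m, DifferentiableOn ℂ (fun z => h m z * (P m).eval z) U := fun m =>
    (hh m).mul (P m).differentiable.differentiableOn
  set f : ℂ → ℂ := fun z => (z - c) ^ k * g z with hf
  -- the limit is itself a polynomial times a function without zeros
  have hfP : f = fun z => g z * ((X - C c) ^ k : ℂ[X]).eval z := by
    ext z; simp [hf, mul_comm]
  have hP : ∀ z ∈ Metric.sphere c R, ((X - C c) ^ k : ℂ[X]).eval z ≠ 0 := by
    intro z hz
    have h1 : z - c ≠ 0 := norm_ne_zero_iff.mp ((mem_sphere_iff_norm.mp hz).trans_ne hR.ne')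
    simpa using pow_ne_zero k h1
  have hk : zerosInDisk ((X - C c) ^ k) c R = k := by
    have h1 : Multiset.countP (fun w => ‖w - c‖ < R) {c} = 1 := by
      rw [← Multiset.cons_zero, Multiset.countP_cons_of_pos (p := fun w => ‖w - c‖ < R) _ (by simpa)]
      simp
    simp [zerosInDisk, roots_pow, Multiset.countP_nsmul, roots_X_sub_C, h1]
  have hfd : DifferentiableOn ℂ f U := by
    rw [hfP]
    exact hg.mul (Polynomial.differentiable _).differentiableOn
  have hf0 : ∀ z ∈ Metric.sphere c R, f z ≠ 0 := by
    intro z hz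
    rw [hfP]
    exact mul_ne_zero (hg0 z (hS hz)) (hP z hz)
  have hlimS : TendstoUniformlyOn (fun m z => h m z * (P m).eval z) f atTop (Metric.sphere c R) :=
    (tendstoLocallyUniformlyOn_iff_tendstoUniformlyOn_of_compact (isCompact_sphere c R)).mp
      (hlim.mono hS)
  have hlog : TendstoUniformlyOn (fun m => logDeriv fun z => h m z * (P m).eval z) (logDeriv f)
      atTop (Metric.sphere c R) := by
    refine (tendstoLocallyUniformlyOn_iff_tendstoUniformlyOn_of_compact
      (isCompact_sphere c R)).mp ?_
    exact ((hlim.deriv (Eventually.of_forall hd) hU).mono hS).div₀ (hlim.mono hS)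
      ((hfd.deriv hU).continuousOn.mono hS) (hfd.continuousOn.mono hS) hf0
  have hne : ∀ᶠ m in atTop, ∀ z ∈ Metric.sphere c R, h m z * (P m).eval z ≠ 0 := by
    obtain ⟨x, hx, hmin⟩ := (isCompact_sphere c R).exists_isMinOn
      (NormedSpace.sphere_nonempty.mpr hR.le) (hfd.continuousOn.mono hS).norm
    filter_upwards [Metric.tendstoUniformlyOn_iff.mp hlimS _ (norm_pos_iff.mpr (hf0 x hx))]
      with m hm z hz hz0
    have h1 := hm z hz
    rw [hz0, dist_zero_right] at h1
    exact absurd (hmin hz) (not_le.mpr h1)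
  have hint := hlog.tendsto_circleIntegral_of_continuousOn hR.le
    (hne.mono fun m hm => continuousOn_logDeriv hU (hd m) hS hm)
  rw [hfP, circleIntegral_logDeriv_mul_eval hU hR hUR hg hg0 _ hP, hk] at hint
  have hcount : Tendsto (fun m => (zerosInDisk (P m) c R : ℂ)) atTop (𝓝 (k : ℂ)) := by
    have h1 := (hint.congr' (hne.mono fun m hm => circleIntegral_logDeriv_mul_eval hU hR hUR (hh m)
      (h0 m) (P m) fun z hz => right_ne_zero_of_mul (hm z hz))).const_mul
        (2 * Real.pi * Complex.I)⁻¹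
    simpa [← mul_assoc, inv_mul_cancel₀ Complex.two_pi_I_ne_zero] using h1
  -- a convergent sequence of integers is eventually constant
  filter_upwards [Metric.tendsto_nhds.mp hcount 1 one_pos] with m hm
  rw [Complex.dist_eq] at hm
  have h1 : ‖((((zerosInDisk (P m) c R : ℤ) - (k : ℤ)) : ℤ) : ℂ)‖ < 1 := by
    push_cast
    exact hm
  rw [Complex.norm_intCast] at h1
  have h2 : |(zerosInDisk (P m) c R : ℤ) - (k : ℤ)| < 1 := by exact_mod_cast h1
  have h3 := Int.abs_lt_one_iff.mp h2
  lia

/-! ### Analyticity off the bands -/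

/-- Where the eigenvalues differ in modulus, `Tr T_p / 2 ± s` with a local analytic branch `s` of the
square root are the eigenvalues of larger and smaller modulus, whatever branch `charSqrt` takes. -/
lemma exists_analyticAt_branch (α : ℕ → ℂ) (p : ℕ) {z₀ : ℂ}
    (hz : ‖lamMinus α p z₀‖ < ‖lamPlus α p z₀‖) :
    ∃ s : ℂ → ℂ, AnalyticAt ℂ s z₀ ∧ ∀ᶠ z in 𝓝 z₀,
      lamPlus α p z = (transfer α p z).trace / 2 + s z ∧
      lamMinus α p z = (transfer α p z).trace / 2 - s z ∧
      ‖lamMinus α p z‖ < ‖lamPlus α p z‖ := by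
  set σ := (lamPlus α p z₀ - lamMinus α p z₀) / 2 with hσ
  have hσ0 : σ ≠ 0 := div_ne_zero (lamPlus_sub_lamMinus_ne_zero hz) two_ne_zero
  have htr : AnalyticAt ℂ (fun z => (transfer α p z).trace) z₀ :=
    (differentiable_trace_transfer α p).analyticAt z₀
  set D : ℂ → ℂ := fun z => ((transfer α p z).trace / 2) ^ 2 - z ^ p with hD
  have hDa : AnalyticAt ℂ D z₀ := by fun_prop
  have hD0 : D z₀ = σ ^ 2 := by
    simp only [hD, hσ, ← lamPlus_add_lamMinus]
    rw [← lamPlus_mul_lamMinus α p z₀]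
    ring
  set s : ℂ → ℂ := fun z => σ * (D z / σ ^ 2) ^ ((1 : ℂ) / 2) with hs
  have hsa : AnalyticAt ℂ s z₀ := by
    refine analyticAt_const.mul ((hDa.div analyticAt_const (pow_ne_zero 2 hσ0)).cpow
      analyticAt_const ?_)
    rw [Pi.div_apply, hD0, div_self (pow_ne_zero 2 hσ0)]
    exact Complex.one_mem_slitPlane
  have hs0 : s z₀ = σ := by
    simp only [hs, hD0, div_self (pow_ne_zero 2 hσ0), Complex.one_cpow, mul_one]
  have hsq : ∀ z, s z ^ 2 = charSqrt α p z ^ 2 := by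
    intro z
    have h1 : ((D z / σ ^ 2) ^ ((1 : ℂ) / 2)) ^ 2 = D z / σ ^ 2 := by
      have := Complex.cpow_nat_inv_pow (D z / σ ^ 2) two_ne_zero
      convert this using 3
      norm_num
    rw [charSqrt_sq, hs, mul_pow, h1, mul_div_cancel₀ _ (pow_ne_zero 2 hσ0)]
  refine ⟨s, hsa, ?_⟩
  have hlt : ∀ᶠ z in 𝓝 z₀,
      ‖(transfer α p z).trace / 2 - s z‖ < ‖(transfer α p z).trace / 2 + s z‖ := by
    have hc := htr.continuousAt
    have hc' := hsa.continuousAt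
    refine ContinuousAt.eventually_lt (by fun_prop) (by fun_prop) ?_
    rw [hs0, hσ, ← lamPlus_add_lamMinus]
    rwa [show (lamPlus α p z₀ + lamMinus α p z₀) / 2 - (lamPlus α p z₀ - lamMinus α p z₀) / 2 =
        lamMinus α p z₀ by ring,
      show (lamPlus α p z₀ + lamMinus α p z₀) / 2 + (lamPlus α p z₀ - lamMinus α p z₀) / 2 =
        lamPlus α p z₀ by ring]
  filter_upwards [hlt] with z hz'
  have hplus : lamPlus α p z = (transfer α p z).trace / 2 + s z := by
    rw [lamPlus]
    rcases sq_eq_sq_iff_eq_or_eq_neg.mp (hsq z) with h | h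
    · rw [← h, if_pos hz'.le]
    · rw [← neg_eq_iff_eq_neg.mpr h, sub_neg_eq_add, ← sub_eq_add_neg, if_neg hz'.not_ge]
  have hminus : lamMinus α p z = (transfer α p z).trace / 2 - s z := by
    rw [lamMinus, hplus]; ring
  exact ⟨hplus, hminus, by rwa [hplus, hminus]⟩

lemma isOpen_setOf_norm_lamMinus_lt (α : ℕ → ℂ) (p : ℕ) :
    IsOpen {z | ‖lamMinus α p z‖ < ‖lamPlus α p z‖} := by
  rw [isOpen_iff_mem_nhds]
  intro z hz
  obtain ⟨s, -, h⟩ := exists_analyticAt_branch α p hz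
  exact h.mono fun z h => h.2.2

lemma analyticAt_lamPlus {α : ℕ → ℂ} {p : ℕ} {z : ℂ}
    (hz : ‖lamMinus α p z‖ < ‖lamPlus α p z‖) : AnalyticAt ℂ (lamPlus α p) z := by
  obtain ⟨s, hs, h⟩ := exists_analyticAt_branch α p hz
  refine (((differentiable_trace_transfer α p).analyticAt z).div_const (c := 2) |>.add hs).congr ?_
  exact h.mono fun z h => h.1.symm

lemma analyticAt_lamMinus {α : ℕ → ℂ} {p : ℕ} {z : ℂ}
    (hz : ‖lamMinus α p z‖ < ‖lamPlus α p z‖) : AnalyticAt ℂ (lamMinus α p) z :=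
  ((differentiable_trace_transfer α p).analyticAt z).sub (analyticAt_lamPlus hz)

lemma analyticAt_jost {α : ℕ → ℂ} {p : ℕ} (hper : ∀ n, α (n + p) = α n) (b : ℕ) {z : ℂ}
    (hz : ‖lamMinus α p z‖ < ‖lamPlus α p z‖) : AnalyticAt ℂ (jost α p b) z := by
  have h1 := analyticAt_lamPlus hz
  have h2 := analyticAt_lamMinus hz
  have h3 : AnalyticAt ℂ (fun z => ((phi α (b + p)).eval z - lamMinus α p z * (phi α b).eval z) /
      (lamPlus α p z - lamMinus α p z)) z :=
    (((phi α (b + p)).differentiable.analyticAt z).sub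
      (h2.mul ((phi α b).differentiable.analyticAt z))).div (h1.sub h2)
      (lamPlus_sub_lamMinus_ne_zero hz)
  refine h3.congr ?_
  filter_upwards [(isOpen_setOf_norm_lamMinus_lt α p).mem_nhds hz] with w hw
  rw [← sub_mul_jost hper b hw, mul_div_cancel_left₀ _ (lamPlus_sub_lamMinus_ne_zero hw)]

/-! ### Locally uniform convergence -/

/-- Geometric sequences with continuous ratio of modulus less than one tend to zero locally
uniformly. -/
lemma tendstoLocallyUniformlyOn_pow_mul {U : Set ℂ} {r h : ℂ → ℂ}
    (hr : ContinuousOn r U) (hh : ContinuousOn h U) (hlt : ∀ z ∈ U, ‖r z‖ < 1) :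
    TendstoLocallyUniformlyOn (fun (m : ℕ) z => r z ^ m * h z) (fun _ => 0) atTop U := by
  rw [Metric.tendstoLocallyUniformlyOn_iff]
  intro ε hε z hz
  obtain ⟨q, hq, hq1⟩ := exists_between (hlt z hz)
  have hq0 : 0 ≤ q := (norm_nonneg _).trans hq.le
  have hr' : ∀ᶠ w in 𝓝[U] z, ‖r w‖ < q := (hr z hz).norm.eventually_lt_const hq
  have hh' : ∀ᶠ w in 𝓝[U] z, ‖h w‖ < ‖h z‖ + 1 :=
    (hh z hz).norm.eventually_lt_const (lt_add_one _)
  refine ⟨_, hr'.and hh', ?_⟩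
  have hlim : Tendsto (fun m : ℕ => q ^ m * (‖h z‖ + 1)) atTop (𝓝 0) := by
    simpa using (tendsto_pow_atTop_nhds_zero_of_lt_one hq0 hq1).mul_const (‖h z‖ + 1)
  filter_upwards [hlim.eventually_lt_const hε] with m hm w hw
  rw [dist_zero_left, norm_mul, norm_pow]
  refine lt_of_le_of_lt ?_ hm
  exact mul_le_mul (pow_le_pow_left₀ (norm_nonneg _) hw.1.le m) hw.2.le (norm_nonneg _)
    (pow_nonneg hq0 m)

/-- The renormalized polynomials `λ₊^{-m} φ_{mp+b}` converge to `j_b`, locally uniformly. -/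
lemma tendstoLocallyUniformlyOn_phi {α : ℕ → ℂ} {p : ℕ} (hα : ∀ n, ‖α n‖ < 1)
    (hper : ∀ n, α (n + p) = α n) (b : ℕ) :
    TendstoLocallyUniformlyOn
      (fun (m : ℕ) z => (lamPlus α p z ^ m)⁻¹ * (phi α (m * p + b)).eval z) (jost α p b) atTop
      {z | ‖lamMinus α p z‖ < ‖lamPlus α p z‖} := by
  set U := {z | ‖lamMinus α p z‖ < ‖lamPlus α p z‖}
  have hne : ∀ z ∈ U, lamPlus α p z ≠ 0 := fun z hz =>
    norm_pos_iff.mp ((norm_nonneg _).trans_lt hz)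
  have h1 := tendstoLocallyUniformlyOn_pow_mul (U := U)
    (r := fun z => lamMinus α p z / lamPlus α p z)
    (h := fun z => (phi α b).eval z - jost α p b z)
    (fun z hz => ((analyticAt_lamMinus hz).div (analyticAt_lamPlus hz)
      (hne z hz)).continuousAt.continuousWithinAt)
    (fun z hz => (((phi α b).differentiable.analyticAt z).sub
      (analyticAt_jost hper b hz)).continuousAt.continuousWithinAt)
    (fun z hz => by
      rw [norm_div]
      exact (div_lt_one ((norm_nonneg _).trans_lt hz)).mpr hz)
  rw [Metric.tendstoLocallyUniformlyOn_iff] at h1 ⊢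
  intro ε hε z hz
  obtain ⟨t, ht, h2⟩ := h1 ε hε z hz
  refine ⟨t ∩ U, inter_mem ht self_mem_nhdsWithin, h2.mono fun m hm w hw => ?_⟩
  have h3 := hm w hw.1
  rw [dist_zero_left] at h3
  rw [dist_comm, dist_eq_norm, eval_phi_mul_period_add hα hper b hw.2]
  have hw0 := pow_ne_zero m (hne w hw.2)
  rwa [show (lamPlus α p w ^ m)⁻¹ * (lamPlus α p w ^ m * jost α p b w +
      lamMinus α p w ^ m * ((phi α b).eval w - jost α p b w)) - jost α p b w =
      (lamMinus α p w / lamPlus α p w) ^ m * ((phi α b).eval w - jost α p b w) by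
    rw [div_pow]; field_simp; ring]

/-- Where `j_b` has a zero of order `k`, Hurwitz's theorem applies on all small disks. -/
lemma exists_radius_zerosInDisk_phi_eq {α : ℕ → ℂ} {p : ℕ} (hα : ∀ n, ‖α n‖ < 1)
    (hper : ∀ n, α (n + p) = α n) (b : ℕ) {z₀ : ℂ} (hz : ‖lamMinus α p z₀‖ < ‖lamPlus α p z₀‖)
    {k : ℕ} (hk : analyticOrderAt (jost α p b) z₀ = (k : ℕ∞)) :
    ∃ ε₀ : ℝ, 0 < ε₀ ∧ ∀ ε : ℝ, 0 < ε → ε ≤ ε₀ → ∃ M : ℕ, ∀ m : ℕ, M ≤ m →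
      zerosInDisk (phi α (m * p + b)) z₀ ε = k := by
  obtain ⟨g, hg, hg0, hgj⟩ := (analyticAt_jost hper b hz).analyticOrderAt_eq_natCast.mp hk
  have hev : ∀ᶠ z in 𝓝 z₀, AnalyticAt ℂ g z ∧ g z ≠ 0 ∧ jost α p b z = (z - z₀) ^ k • g z ∧
      ‖lamMinus α p z‖ < ‖lamPlus α p z‖ := by
    filter_upwards [hg.eventually_analyticAt, hg.continuousAt.eventually_ne hg0, hgj,
      (isOpen_setOf_norm_lamMinus_lt α p).mem_nhds hz] with z h1 h2 h3 h4 using ⟨h1, h2, h3, h4⟩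
  obtain ⟨r, hr, hball⟩ := Metric.eventually_nhds_iff_ball.mp hev
  refine ⟨r / 2, half_pos hr, fun ε hε hεr => ?_⟩
  have hsub : Metric.closedBall z₀ ε ⊆ Metric.ball z₀ r :=
    Metric.closedBall_subset_ball (by linarith)
  have hlim : TendstoLocallyUniformlyOn
      (fun (m : ℕ) z => (lamPlus α p z ^ m)⁻¹ * (phi α (m * p + b)).eval z)
      (fun z => (z - z₀) ^ k * g z) atTop (Metric.ball z₀ r) :=
    ((tendstoLocallyUniformlyOn_phi hα hper b).mono fun z hz => (hball z hz).2.2.2).congr_right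
      fun z hz => (hball z hz).2.2.1
  have hne : ∀ (m : ℕ), ∀ z ∈ Metric.ball z₀ r, lamPlus α p z ^ m ≠ 0 := fun m z hz =>
    pow_ne_zero m (norm_pos_iff.mp ((norm_nonneg _).trans_lt (hball z hz).2.2.2))
  exact eventually_atTop.mp <| eventually_zerosInDisk_eq Metric.isOpen_ball hε hsub
    (fun z hz => (hball z hz).1.differentiableAt.differentiableWithinAt)
    (fun z hz => (hball z hz).2.1)
    (fun m z hz => (((analyticAt_lamPlus (hball z hz).2.2.2).pow m).inv
      (hne m z hz)).differentiableAt.differentiableWithinAt)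
    (fun m z hz => inv_ne_zero (hne m z hz)) hlim

/-- Near a point where `j_b` does not vanish, eventually neither do the polynomials. -/
lemma exists_radius_phi_ne_zero {α : ℕ → ℂ} {p : ℕ} (hα : ∀ n, ‖α n‖ < 1)
    (hper : ∀ n, α (n + p) = α n) (b : ℕ) {z₀ : ℂ} (hz : ‖lamMinus α p z₀‖ < ‖lamPlus α p z₀‖)
    (hj : jost α p b z₀ ≠ 0) :
    ∃ ε : ℝ, 0 < ε ∧ ∃ M : ℕ, ∀ m : ℕ, M ≤ m → ∀ z : ℂ, ‖z - z₀‖ < ε →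
      (phi α (m * p + b)).eval z ≠ 0 := by
  have hU := (isOpen_setOf_norm_lamMinus_lt α p).mem_nhds hz
  have hlim := tendstoLocallyUniformlyOn_phi hα hper b
  have hpos : 0 < ‖jost α p b z₀‖ / 2 := half_pos (norm_pos_iff.mpr hj)
  obtain ⟨t, ht, h1⟩ := Metric.tendstoLocallyUniformlyOn_iff.mp hlim _ hpos z₀ hz
  rw [nhdsWithin_eq_nhds.mpr hU] at ht
  have hbig : ∀ᶠ z in 𝓝 z₀, ‖jost α p b z₀‖ / 2 < ‖jost α p b z‖ :=
    (analyticAt_jost hper b hz).continuousAt.norm.eventually_const_lt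
      (half_lt_self (norm_pos_iff.mpr hj))
  obtain ⟨ε, hε, hball⟩ := Metric.eventually_nhds_iff.mp (hbig.and ht)
  obtain ⟨M, hM⟩ := eventually_atTop.mp h1
  refine ⟨ε, hε, M, fun m hm z hzε h0 => ?_⟩
  have h2 := hball (y := z) (by rwa [dist_eq_norm])
  have h3 := hM m hm z h2.2
  rw [h0, mul_zero, dist_zero_right] at h3
  exact absurd h3 h2.1.not_gt

/-! ### Counting the zeros of the Jost function -/

/-- The polynomial `φ_{b+p}² - φ_b φ_{b+2p}`, which vanishes at all zeros of `j_b`: there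
`φ_b, φ_{b+p}, φ_{b+2p}` is a geometric progression with ratio `λ₋`. -/
def jostResultant (α : ℕ → ℂ) (p b : ℕ) : ℂ[X] :=
  phi α (b + p) ^ 2 - phi α b * phi α (b + p + p)

lemma eval_jostResultant_of_jost_eq_zero {α : ℕ → ℂ} {p : ℕ} (hα : ∀ n, ‖α n‖ < 1)
    (hper : ∀ n, α (n + p) = α n) {b : ℕ} {z : ℂ} (hz : ‖lamMinus α p z‖ < ‖lamPlus α p z‖)
    (hj : jost α p b z = 0) : (jostResultant α p b).eval z = 0 := by
  have h1 := sub_mul_jost hper b hz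
  rw [hj, mul_zero] at h1
  have h2 := lamPlus_add_lamMinus α p z
  have h3 := lamPlus_mul_lamMinus α p z
  have h4 : (phi α (b + p)).eval z = lamMinus α p z * (phi α b).eval z := by
    linear_combination -h1
  rw [jostResultant, eval_sub, eval_pow, eval_mul, eval_phi_add_two_period hα hper, ← h2, ← h3, h4]
  ring

lemma prod_rho_inv_add_period {α : ℕ → ℂ} {p : ℕ} (hper : ∀ n, α (n + p) = α n) (n : ℕ) :
    ∏ k ∈ Finset.range (n + p), (rho α k : ℂ)⁻¹ =
      (∏ k ∈ Finset.range p, (rho α k : ℂ)⁻¹) * ∏ k ∈ Finset.range n, (rho α k : ℂ)⁻¹ := by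
  rw [add_comm n p, Finset.prod_range_add]
  congr 1
  refine Finset.prod_congr rfl fun k _ => ?_
  rw [rho, rho, add_comm, hper]

/-- The leading coefficients in `φ_{b+p}² - φ_b φ_{b+2p}` cancel by periodicity. -/
lemma natDegree_jostResultant_le {α : ℕ → ℂ} {p : ℕ} (hp : 0 < p) (hper : ∀ n, α (n + p) = α n)
    (b : ℕ) : (jostResultant α p b).natDegree ≤ 2 * p + 2 * b - 1 := by
  rw [natDegree_le_iff_coeff_eq_zero]
  intro N hN
  have hd := natDegree_phi_le α
  rcases eq_or_lt_of_le (show 2 * p + 2 * b ≤ N by lia) with rfl | hlt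
  · have e1 : (phi α (b + p) ^ 2).coeff (2 * p + 2 * b) = (phi α (b + p)).coeff (b + p) ^ 2 := by
      rw [show 2 * p + 2 * b = (b + p) + (b + p) by ring, sq, sq,
        coeff_mul_add_eq_of_natDegree_le (hd _) (hd _)]
    have e2 : (phi α b * phi α (b + p + p)).coeff (2 * p + 2 * b) =
        (phi α b).coeff b * (phi α (b + p + p)).coeff (b + p + p) := by
      rw [show 2 * p + 2 * b = b + (b + p + p) by ring,
        coeff_mul_add_eq_of_natDegree_le (hd _) (hd _)]
    rw [jostResultant, coeff_sub, e1, e2, coeff_phi_self, coeff_phi_self, coeff_phi_self,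
      prod_rho_inv_add_period hper (b + p), prod_rho_inv_add_period hper b]
    ring
  · refine coeff_eq_zero_of_natDegree_lt (lt_of_le_of_lt ?_ hlt)
    refine (natDegree_sub_le _ _).trans (max_le ?_ ?_)
    · exact natDegree_pow_le.trans (by have := hd (b + p); lia)
    · exact natDegree_mul_le.trans (by have := hd b; have := hd (b + p + p); lia)

/-- If the upper right entry of a transfer matrix vanishes on the punctured unit disk, the
coefficients in that matrix are zero. -/
lemma eq_zero_of_transfer_apply_eq_zero {α : ℕ → ℂ} (hα : ∀ n, ‖α n‖ < 1) (n : ℕ)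
    (h : ∀ z : ℂ, z ≠ 0 → ‖z‖ < 1 → transfer α n z 0 1 = 0) : ∀ k < n, α k = 0 := by
  induction n with
  | zero => simp
  | succ n ih =>
    have hrho := inv_ne_zero (rho_ne_zero (hα n))
    have hentry : ∀ z, transfer α (n + 1) z 0 1 = (rho α n : ℂ)⁻¹ *
        (z * transfer α n z 0 1 - starRingEnd ℂ (α n) * transfer α n z 1 1) := by
      intro z
      simp [transfer, stepMatrix, Matrix.mul_apply, Fin.sum_univ_two]
      ring
    -- at the origin only the lower right entry of `T_n` enters, and it is at least one in modulus
    have hzero : transfer α (n + 1) 0 0 1 = 0 := by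
      have hev : (fun z => transfer α (n + 1) z 0 1) =ᶠ[𝓝[≠] 0] fun _ => (0 : ℂ) := by
        have hb : ∀ᶠ z : ℂ in 𝓝[≠] 0, ‖z‖ < 1 :=
          nhdsWithin_le_nhds (continuous_norm.continuousAt.eventually_lt_const (by simp))
        filter_upwards [hb, self_mem_nhdsWithin] with z h1 h2 using h z h2 h1
      exact tendsto_nhds_unique
        (((differentiable_transfer α (n + 1) 0 1).continuous.tendsto 0).mono_left
          nhdsWithin_le_nhds) (tendsto_const_nhds.congr' hev.symm)
    have h22 : transfer α n 0 1 1 ≠ 0 := by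
      intro h0
      have h1 := sig_le_sig_transfer hα (z := 0) (by simp) n ![0, 1]
      simp [sig, Matrix.mulVec, dotProduct, Fin.sum_univ_two, h0] at h1
      nlinarith [sq_nonneg ‖transfer α n 0 0 1‖]
    have hn : α n = 0 := by
      rw [hentry, zero_mul, zero_sub] at hzero
      simpa [hrho, h22, (rho_pos (hα n)).ne'] using hzero
    intro k hk
    rcases eq_or_lt_of_le (Nat.lt_succ_iff.mp hk) with rfl | hlt
    · exact hn
    · refine ih (fun z hz hz1 => ?_) k hlt
      have h1 := h z hz hz1
      rw [hentry, hn, map_zero, zero_mul, sub_zero] at h1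
      exact (mul_eq_zero.mp ((mul_eq_zero.mp h1).resolve_left hrho)).resolve_left hz

/-- A factorization of the resultant: with `x = T_b (1, 1)` and `S` the monodromy matrix that
begins at `b`, it is a multiple of the upper right entry of `S` by `det (x, S x)`, and the latter is
`det T_b` times `det ((1, 1), T_p (1, 1))`. -/
lemma eval_jostResultant {α : ℕ → ℂ} {p : ℕ} (hα : ∀ n, ‖α n‖ < 1)
    (hper : ∀ n, α (n + p) = α n) (b : ℕ) (z : ℂ) :
    (jostResultant α p b).eval z = transfer (fun k => α (b + k)) p z 0 1 * z ^ b *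
      ((phi α p).eval z - (star p (phi α p)).eval z) := by
  have hS : transfer (fun k => α (b + k)) p z * transfer α b z =
      transfer α b z * transfer α p z := by
    rw [← transfer_add, transfer_period_add hper]
  have hdet := det_transfer hα b z
  set S := transfer (fun k => α (b + k)) p z
  set M := transfer α b z with hM
  have hv := transfer_mulVec_one_one α p z
  have h1 : (phi α (b + p)).eval z = M.mulVec ![(phi α p).eval z, (star p (phi α p)).eval z] 0 := by
    rw [eval_phi, transfer_period_add hper, ← Matrix.mulVec_mulVec, hv]
  have h2 : (phi α (b + p + p)).eval z =
      S.mulVec (M.mulVec ![(phi α p).eval z, (star p (phi α p)).eval z]) 0 := by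
    rw [eval_phi, transfer_period_add hper, transfer_period_add hper, ← hS,
      ← Matrix.mulVec_mulVec, hv, ← Matrix.mulVec_mulVec]
  have h3 : S.mulVec (M.mulVec ![1, 1]) =
      M.mulVec ![(phi α p).eval z, (star p (phi α p)).eval z] := by
    rw [Matrix.mulVec_mulVec, hS, ← Matrix.mulVec_mulVec, hv]
  rw [jostResultant, eval_sub, eval_pow, eval_mul, h1, h2, eval_phi α b, ← hM, ← hdet,
    Matrix.det_fin_two]
  have h4 := congrFun h3 0
  generalize (phi α p).eval z = x at *
  generalize (star p (phi α p)).eval z = y at *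
  simp only [Matrix.mulVec, dotProduct, Fin.sum_univ_two, Matrix.cons_val_zero,
    Matrix.cons_val_one, mul_one] at h4 ⊢
  linear_combination -(M 0 0 * x + M 0 1 * y) * h4

lemma jostResultant_ne_zero {α : ℕ → ℂ} {p : ℕ} (hp : 0 < p) (hα : ∀ n, ‖α n‖ < 1)
    (hper : ∀ n, α (n + p) = α n) (hne : ∃ n, α n ≠ 0) (b : ℕ) : jostResultant α p b ≠ 0 := by
  intro h0
  have hzero : ∀ k < p, α (b + k) = 0 := by
    refine eq_zero_of_transfer_apply_eq_zero (fun n => hα (b + n)) p fun z hz hz1 => ?_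
    have h1 := eval_jostResultant hα hper b z
    rw [h0, eval_zero, eq_comm, mul_eq_zero, mul_eq_zero] at h1
    rcases h1 with (h1 | h1) | h1
    · exact h1
    · exact absurd h1 (pow_ne_zero b hz)
    · -- inside the disk `|φ_p| < |φ_p^*|`
      have he0 : (![1, 1] : Fin 2 → ℂ) ≠ 0 := fun h0 => by simpa using congrFun h0 0
      have h2 := pow_mul_sig_lt_sig_transfer hα hz hz1 hp he0
      rw [transfer_mulVec_one_one, sub_eq_zero.mp h1] at h2
      simp [sig] at h2
  obtain ⟨n, hn⟩ := hne
  refine hn ?_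
  have hper' : ∀ m n, α (n + m * p) = α n := by
    intro m
    induction m with
    | zero => simp
    | succ m ih => intro n; rw [add_mul, one_mul, ← add_assoc, hper, ih]
  -- shift `n` beyond `b` by a multiple of the period, and then back into the window
  have h1 : b ≤ n + b * p := (Nat.le_mul_of_pos_right b hp).trans (Nat.le_add_left _ _)
  rw [← hper' b n, show n + b * p =
    b + (n + b * p - b) % p + ((n + b * p - b) / p) * p by
      have := Nat.mod_add_div' (n + b * p - b) p; lia, hper']
  exact hzero _ (Nat.mod_lt _ hp)

lemma encard_zeros_jost_le {α : ℕ → ℂ} {p : ℕ} (hp : 0 < p) (hα : ∀ n, ‖α n‖ < 1)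
    (hper : ∀ n, α (n + p) = α n) (hne : ∃ n, α n ≠ 0) (b : ℕ) :
    {z : ℂ | ‖lamMinus α p z‖ < ‖lamPlus α p z‖ ∧ jost α p b z = 0}.encard ≤
      ((2 * p + 2 * b - 1 : ℕ) : ℕ∞) := by
  have hsub : {z : ℂ | ‖lamMinus α p z‖ < ‖lamPlus α p z‖ ∧ jost α p b z = 0} ⊆
      ((jostResultant α p b).roots.toFinset : Set ℂ) := by
    rintro z ⟨hz, hj⟩
    simpa [jostResultant_ne_zero hp hα hper hne b] using
      eval_jostResultant_of_jost_eq_zero hα hper hz hj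
  refine (Set.encard_le_encard hsub).trans ?_
  rw [Set.encard_coe_eq_coe_finsetCard]
  exact_mod_cast (Multiset.toFinset_card_le _).trans
    ((card_roots' _).trans (natDegree_jostResultant_le hp hper b))

end OPUC

end

theorem theorem3p2 (α : ℕ → ℂ) (p b : ℕ) (hp : 0 < p) (hpe : Even p)
    (hα : ∀ n, ‖α n‖ < 1) (hper : ∀ n, α (n + p) = α n) :
    -- the limit, for nonzero points off the bands
    (∀ z : ℂ, z ∉ OPUC.bands α p → z ≠ 0 →
      Tendsto (fun m : ℕ => (z ^ (m * (p / 2)))⁻¹ * (OPUC.gammaPlus α p z ^ m)⁻¹ *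
        (OPUC.phi α (m * p + b)).eval z) atTop (𝓝 (OPUC.jost α p b z))) ∧
    -- the same limit written with z^(p/2) Γ_+(z), which also makes sense at z = 0
    (∀ z : ℂ, z ∉ OPUC.bands α p →
      Tendsto (fun m : ℕ => (OPUC.lamPlus α p z ^ m)⁻¹ *
        (OPUC.phi α (m * p + b)).eval z) atTop (𝓝 (OPUC.jost α p b z))) ∧
    -- j_b is analytic off the bands, so that orders of its zeros make sense
    AnalyticOnNhd ℂ (OPUC.jost α p b) (OPUC.bands α p)ᶜ ∧
    -- j_b does not vanish near infinity
    (∃ R : ℝ, ∀ z : ℂ, R < ‖z‖ → OPUC.jost α p b z ≠ 0) ∧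
    -- no zeros near points where j_b is nonzero
    (∀ z₀ : ℂ, z₀ ∉ OPUC.bands α p → OPUC.jost α p b z₀ ≠ 0 →
      ∃ ε : ℝ, 0 < ε ∧ ∃ M : ℕ, ∀ m : ℕ, M ≤ m → ∀ z : ℂ, ‖z - z₀‖ < ε →
        (OPUC.phi α (m * p + b)).eval z ≠ 0) ∧
    -- precisely k zeros in all small disks about a zero of order k
    (∀ z₀ : ℂ, z₀ ∉ OPUC.bands α p → ∀ k : ℕ,
      analyticOrderAt (OPUC.jost α p b) z₀ = (k : ℕ∞) →
      ∃ ε₀ : ℝ, 0 < ε₀ ∧ ∀ ε : ℝ, 0 < ε → ε ≤ ε₀ → ∃ M : ℕ, ∀ m : ℕ, M ≤ m →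
        OPUC.zerosInDisk (OPUC.phi α (m * p + b)) z₀ ε = k) ∧
    -- the bound on the number of zeros of j_b
    ((∃ n, α n ≠ 0) →
      {z : ℂ | z ∉ OPUC.bands α p ∧ OPUC.jost α p b z = 0}.encard
        ≤ ((2 * p + 2 * b - 1 : ℕ) : ℕ∞)) := by
  have hsep : ∀ z, z ∉ OPUC.bands α p → ‖OPUC.lamMinus α p z‖ < ‖OPUC.lamPlus α p z‖ :=
    fun z hz => OPUC.norm_lamMinus_lt hp hpe hα hz
  have hlim : ∀ z : ℂ, z ∉ OPUC.bands α p →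
      Tendsto (fun m : ℕ => (OPUC.lamPlus α p z ^ m)⁻¹ *
        (OPUC.phi α (m * p + b)).eval z) atTop (𝓝 (OPUC.jost α p b z)) := fun z hz =>
    (OPUC.tendstoLocallyUniformlyOn_phi hα hper b).tendsto_at (hsep z hz)
  refine ⟨fun z hz hz0 => ?_, hlim, fun z hz => OPUC.analyticAt_jost hper b (hsep z hz),
    ⟨1, fun z hz => OPUC.jost_ne_zero_of_one_lt_norm hp hpe hα b hz⟩,
    fun z hz hj => OPUC.exists_radius_phi_ne_zero hα hper b (hsep z hz) hj,
    fun z hz k hk => OPUC.exists_radius_zerosInDisk_phi_eq hα hper b (hsep z hz) hk,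
    fun hne => (Set.encard_le_encard fun z hz => And.intro (hsep z hz.1) hz.2).trans
      (OPUC.encard_zeros_jost_le hp hα hper hne b)⟩
  refine (hlim z hz).congr fun m => ?_
  have h0 : z ^ (p / 2) ≠ 0 := pow_ne_zero _ hz0
  rw [← mul_inv, pow_mul', ← mul_pow, OPUC.gammaPlus, mul_inv_cancel_left₀ h0]
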